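/- Let $(a_n)_{n\ge1}$ be nonnegative reals, not all zero, let $s\in(0,\infty]$ be such that $C(x)=\sum_{n\ge1}a_nx^n$ converges for every $x\in(0,s)$, and let $\theta\in(0,s)$. Put $p_n=a_n\theta^n/C(\theta)$ and let $N$ be a random variable with $P(N=n)=p_n$ for $n\ge1$. Let $\phi,\Phi$ be the standard normal density and distribution function, let $\Phi_m(x;\Sigma)$ be the distribution function at $x\in\mathbb R^m$ of the centred $m$-variate normal law with covariance matrix $\Sigma$ (with $\Phi_0=1$), let $I_m$ be the identity matrix and $1_m\in\mathbb R^m$ the vector of ones. Let $X_{(n)}$ be the maximum of $n$ independent standard normal variables, and for $m\ge0$ let $Z_m$ have the (unified skew-normal) density $$z\mapsto\frac{\phi(z)\,\Phi_m\!\left(\tfrac{z}{\sqrt2}1_m;I_m\right)}{\Phi_m\!\left(0;I_m+\tfrac12 1_m1_m^T\right)}.$$ Suppose $Y\sim NPS(0,1,\theta)$, i.e. $Y$ has distribution function $y\mapsto C(\theta\Phi(y))/C(\theta)$. Then $E(e^{tY})<\infty$ for all $t\in\mathbb R$, all moments of $Y$ and of each $Z_m$ are finite, all series below converge, and the following hold.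 1. For every $t\in\mathbb R$, $$M_Y(t)=E(e^{tY})=\sum_{n\ge1}p_nM_{X_{(n)}}(t)=e^{t^2/2}\sum_{n\ge1}p_n\,n\,\Phi_{n-1}(t1_{n-1};I_{n-1}+1_{n-1}1_{n-1}^T)=e^{t^2/2}\,E\!\left(N\,\Phi_{N-1}(t1_{N-1};I_{N-1}+1_{N-1}1_{N-1}^T)\right).$$ 2. For every integer $k\ge1$, $$E(Y^{k+1})=\sum_{n\ge1}p_n\,k\,E(Y^{k-1})+\sum_{n\ge1}p_n\,\frac{(n-1)\,\Phi_{n-2}\!\left(0;I_{n-2}+\tfrac12 1_{n-2}1_{n-2}^T\right)}{2\sqrt\pi\;2^{k/2}\;\Phi_{n-1}\!\left(0;I_{n-1}+1_{n-1}1_{n-1}^T\right)}\,E(Z_{n-2}^{k}).$$ 3. $$E(Y)=\frac1{2\sqrt\pi}\sum_{n\ge1}p_n\,n(n-1)\,\Phi_{n-2}\!\left(0;I_{n-2}+\tfrac12 1_{n-2}1_{n-2}^T\right).$$ In 2 and 3 the term with $n=1$ in the sums containing $\Phi_{n-2}$ is $0$, because of its factor $n-1$. -/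

import Mathlib

open MeasureTheory ProbabilityTheory

noncomputable section

namespace NPS

/-- The standard normal distribution function `Φ`. -/
def stdNormalCDF (x : ℝ) : ℝ := cdf (gaussianReal 0 1) x

/-- The standard normal density `φ`. -/
def stdNormalPDF (x : ℝ) : ℝ := gaussianPDFReal 0 1 x

/-- `Φ_k(x; S)`: the distribution function at `x` of the centred `k`-variate normal distribution
with covariance matrix `S` (`S` positive semidefinite). For `k = 0` its value is `1`. -/
def mvnCDF {k : ℕ} (x : Fin k → ℝ) (S : Matrix (Fin k) (Fin k) ℝ) : ℝ :=
  (multivariateGaussian (0 : EuclideanSpace ℝ (Fin k)) S).real {z | ∀ i, z i ≤ x i}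

/-- The vector `1_k` of ones. -/
def ones (k : ℕ) : Fin k → ℝ := fun _ => 1

/-- The matrix `I_k + c 1_k 1_kᵀ`. -/
def equiCov (k : ℕ) (c : ℝ) : Matrix (Fin k) (Fin k) ℝ :=
  1 + c • Matrix.vecMulVec (ones k) (ones k)

/-- `C(θ) = ∑_{n ≥ 1} a_n θ ^ n`. -/
def powerSeries (a : ℕ+ → ℝ) (θ : ℝ) : ℝ := ∑' n : ℕ+, a n * θ ^ (n : ℕ)

/-- The power series probability mass function `P(N = n) = a_n θ ^ n / C(θ)`, `n ≥ 1`. -/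
def powerSeriesPMF (a : ℕ+ → ℝ) (θ : ℝ) (n : ℕ+) : ℝ :=
  a n * θ ^ (n : ℕ) / powerSeries a θ

/-- The law on `ℕ` of `N`, the (zero-truncated) power series distribution: it gives mass
`a_n θ ^ n / C(θ)` to each `n ≥ 1`, and mass `0` to `0`. -/
def powerSeriesLaw (a : ℕ+ → ℝ) (θ : ℝ) : Measure ℕ :=
  Measure.sum fun n : ℕ+ => ENNReal.ofReal (powerSeriesPMF a θ n) • Measure.dirac (n : ℕ)

/-- The law of `X_(n) = max (X_1, …, X_n)` for independent standard normal `X_1, …, X_n`. -/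
def normalMaxLaw (n : ℕ+) : Measure ℝ :=
  (Measure.pi fun _ : Fin (n : ℕ) => gaussianReal 0 1).map fun x => ⨆ i, x i

/-- The distribution function `F(y; μ, σ, θ) = C(θ Φ((y - μ) / σ)) / C(θ)` of `NPS(μ, σ, θ)`. -/
def cdfNPS (a : ℕ+ → ℝ) (μ σ θ y : ℝ) : ℝ :=
  powerSeries a (θ * stdNormalCDF ((y - μ) / σ)) / powerSeries a θ

/-- `Y ∼ NPS(μ, σ, θ)`: `Y` is a random variable on `(Ω, P)` whose distribution function is
`cdfNPS a μ σ θ`. -/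
structure HasLawNPS {Ω : Type*} [MeasurableSpace Ω] (Y : Ω → ℝ) (P : Measure Ω)
    (a : ℕ+ → ℝ) (μ σ θ : ℝ) : Prop where
  aemeasurable : AEMeasurable Y P
  cdf_eq : ∀ y : ℝ, P.real {ω | Y ω ≤ y} = cdfNPS a μ σ θ y

/-- The unified skew-normal density
`φ(z) Φ_k(lam z + γ; S) / Φ_k(γ; S + lam lamᵀ)`. -/
def skewNormalPDF {k : ℕ} (lam γ : Fin k → ℝ) (S : Matrix (Fin k) (Fin k) ℝ) (z : ℝ) : ℝ :=
  stdNormalPDF z * mvnCDF (z • lam + γ) S / mvnCDF γ (S + Matrix.vecMulVec lam lam)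

/-- The unified skew-normal law `SN(k, (lam, γ, S))`, that is, the law of `Z_{k, (lam, γ, S)}`. -/
def skewNormalLaw {k : ℕ} (lam γ : Fin k → ℝ) (S : Matrix (Fin k) (Fin k) ℝ) : Measure ℝ :=
  volume.withDensity fun z => ENNReal.ofReal (skewNormalPDF lam γ S z)

/-- The law of `Z_{k, lam, I_k}` with `γ = 0` and `lam = (1 / √2) 1_k`. -/
def halfSkewLaw (k : ℕ) : Measure ℝ :=
  skewNormalLaw ((1 / √2 : ℝ) • ones k) 0 1

end NPS

end

noncomputable section

namespace NPS

/-! Expanding C(θΦ(y))/C(θ) = ∑ p_n Φ(y)^n shows that the law of Y is the mixture, with weights p_n,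
of the laws of the maxima X_(n) (`HasLawNPS.map_eq`). Since X_(n) has density nΦ^(n-1) ≤ n with
respect to the standard normal law, and E(N) is finite because θ < s, the law of Y is at most E(N)
times the standard normal law. Every Gaussian-integrable function is thus integrable under Y, and
its expectation is the p_n-weighted series (`HasLawNPS.hasSum_integral_comp`). It remains to treat
each X_(n).

For the mgf, multiplying the Gaussian weight by e^(tx) shifts it by t, leaving n E(Φ(t+W)^(n-1))
with W standard normal; conditioning on W identifies this expectation with an orthant probability
for covariance I + 11ᵀ (`mvnCDF_equiCov`). For the moments, Stein's identity is applied to x^k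
nΦ(x)^(n-1): differentiating the power gives the lower moment, differentiating Φ^(n-1) gives a term
with an extra factor φ, and rescaling by √2 turns φ² into the density of the skew-normal Z_(n-2). -/

/-! ### Orthant probabilities for covariance I + v vᵀ -/

open Matrix in
lemma posSemidef_one_add_vecMulVec {k : ℕ} (v : Fin k → ℝ) :
    (1 + vecMulVec v v).PosSemidef := by
  have h := posSemidef_vecMulVec_self_star v
  rw [star_trivial] at h
  exact PosSemidef.one.add h

/-- If `X` is a standard Gaussian vector and `W` an independent standard normal variable, then
`X - W v` is a centred Gaussian vector with covariance matrix `I + v vᵀ`. -/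
lemma multivariateGaussian_one_add_vecMulVec {k : ℕ} (v : Fin k → ℝ) :
    multivariateGaussian (0 : EuclideanSpace ℝ (Fin k)) (1 + Matrix.vecMulVec v v) =
      ((gaussianReal 0 1).map fun w : ℝ => -w • (WithLp.toLp 2 v : EuclideanSpace ℝ (Fin k))) ∗
        stdGaussian (EuclideanSpace ℝ (Fin k)) := by
  have : IsProbabilityMeasure ((gaussianReal 0 1).map
      fun w : ℝ => -w • (WithLp.toLp 2 v : EuclideanSpace ℝ (Fin k))) :=
    Measure.isProbabilityMeasure_map (by fun_prop)
  apply Measure.ext_of_charFun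
  ext t
  rw [charFun_conv, charFun_multivariateGaussian (posSemidef_one_add_vecMulVec v),
    charFun_stdGaussian]
  have h1 : charFun ((gaussianReal 0 1).map
      fun w : ℝ => -w • (WithLp.toLp 2 v : EuclideanSpace ℝ (Fin k))) t =
      charFun (gaussianReal 0 1) (-(v ⬝ᵥ t)) := by
    rw [charFun_apply, charFun_apply_real, integral_map (by fun_prop)
      (Measurable.aestronglyMeasurable (by fun_prop))]
    congr 1
    ext w
    congr 2
    rw [inner_smul_left, EuclideanSpace.inner_eq_star_dotProduct]
    simp [dotProduct_comm]
    ring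
  have h2 : ((‖t‖ : ℂ)) ^ 2 = ((t ⬝ᵥ t : ℝ) : ℂ) := by
    rw [← Complex.ofReal_pow, EuclideanSpace.real_norm_sq_eq]; simp [dotProduct, sq]
  rw [h1, charFun_gaussianReal, ← Complex.exp_add]
  congr 1
  rw [h2, Matrix.add_mulVec, Matrix.vecMulVec_mulVec, Matrix.one_mulVec,
    dotProduct_add]
  simp [dotProduct_comm, dotProduct_smul]
  ring

lemma stdNormalCDF_nonneg (x : ℝ) : 0 ≤ stdNormalCDF x := cdf_nonneg _ _

lemma stdGaussian_orthant {k : ℕ} (x : Fin k → ℝ) :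
    (stdGaussian (EuclideanSpace ℝ (Fin k))) {z | ∀ i, z i ≤ x i} =
      ENNReal.ofReal (∏ i, stdNormalCDF (x i)) := by
  have hs : MeasurableSet {z : EuclideanSpace ℝ (Fin k) | ∀ i, z i ≤ x i} := by
    simp only [Set.ofPred_forall]
    exact MeasurableSet.iInter fun i => measurableSet_le (by fun_prop) (by fun_prop)
  rw [← map_pi_eq_stdGaussian, Measure.map_apply (by fun_prop) hs]
  have : (WithLp.toLp 2 ⁻¹' {z : EuclideanSpace ℝ (Fin k) | ∀ i, z i ≤ x i}) =
      Set.univ.pi fun i => Set.Iic (x i) := by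
    ext z; simp [Pi.le_def]
  rw [this, Measure.pi_pi, ENNReal.ofReal_prod_of_nonneg fun i _ => stdNormalCDF_nonneg _]
  simp [stdNormalCDF, ofReal_cdf]

lemma mvnCDF_nonneg {k : ℕ} (x : Fin k → ℝ) (S : Matrix (Fin k) (Fin k) ℝ) : 0 ≤ mvnCDF x S :=
  measureReal_nonneg

lemma mvnCDF_one {k : ℕ} (x : Fin k → ℝ) : mvnCDF x 1 = ∏ i, stdNormalCDF (x i) := by
  rw [mvnCDF, multivariateGaussian_zero_one, measureReal_def, stdGaussian_orthant,
    ENNReal.toReal_ofReal (Finset.prod_nonneg fun i _ => stdNormalCDF_nonneg _)]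

lemma measurable_stdNormalCDF : Measurable stdNormalCDF :=
  (monotone_cdf (gaussianReal 0 1)).measurable

/-- Conditionally on W = w, the event X - w v ≤ x is X_i ≤ x_i + w v_i for all i, and the X_i are
independent. -/
lemma mvnCDF_one_add_vecMulVec {k : ℕ} (x v : Fin k → ℝ) :
    mvnCDF x (1 + Matrix.vecMulVec v v) =
      ∫ w, ∏ i, stdNormalCDF (x i + w * v i) ∂gaussianReal 0 1 := by
  have hs : MeasurableSet {z : EuclideanSpace ℝ (Fin k) | ∀ i, z i ≤ x i} := by
    simp only [Set.ofPred_forall]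
    exact MeasurableSet.iInter fun i => measurableSet_le (by fun_prop) (by fun_prop)
  have : IsProbabilityMeasure ((gaussianReal 0 1).map
      fun w : ℝ => -w • (WithLp.toLp 2 v : EuclideanSpace ℝ (Fin k))) :=
    Measure.isProbabilityMeasure_map (by fun_prop)
  have hm : Measurable fun w => ∏ i, stdNormalCDF (x i + w * v i) :=
    Finset.measurable_prod _ fun i _ => measurable_stdNormalCDF.comp (by fun_prop)
  have hadd : Measurable fun p : EuclideanSpace ℝ (Fin k) × EuclideanSpace ℝ (Fin k) =>
      p.1 + p.2 := by fun_prop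
  rw [mvnCDF, multivariateGaussian_one_add_vecMulVec, measureReal_def, Measure.conv,
    Measure.map_apply (by fun_prop) hs,
    Measure.prod_apply (hadd hs),
    lintegral_map (measurable_measure_prodMk_left (hadd hs))
      (by fun_prop),
    integral_eq_lintegral_of_nonneg_ae
      (.of_forall fun w => Finset.prod_nonneg fun i _ => stdNormalCDF_nonneg _) hm.aestronglyMeasurable]
  congr 1
  refine lintegral_congr fun w => ?_
  rw [← stdGaussian_orthant]
  congr 1
  ext z
  simp [neg_add_eq_sub]

lemma equiCov_eq (k : ℕ) (r : ℝ) :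
    equiCov k (r ^ 2) = 1 + Matrix.vecMulVec (r • ones k) (r • ones k) := by
  rw [equiCov, Matrix.smul_vecMulVec, Matrix.vecMulVec_smul, smul_smul, sq]

lemma mvnCDF_equiCov (k : ℕ) (t r : ℝ) :
    mvnCDF (t • ones k) (equiCov k (r ^ 2)) =
      ∫ w, stdNormalCDF (t + r * w) ^ k ∂gaussianReal 0 1 := by
  rw [equiCov_eq, mvnCDF_one_add_vecMulVec]
  simp [ones, mul_comm]

/-! ### Calculus of φ and Φ, and Stein's identity -/

lemma stdNormalPDF_eq (x : ℝ) :
    stdNormalPDF x = (√(2 * Real.pi))⁻¹ * Real.exp (-x ^ 2 / 2) := by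
  simp [stdNormalPDF, gaussianPDFReal]

lemma stdNormalPDF_pos (x : ℝ) : 0 < stdNormalPDF x :=
  gaussianPDFReal_pos _ _ _ one_ne_zero

lemma integrable_stdNormalPDF : Integrable stdNormalPDF := integrable_gaussianPDFReal 0 1

lemma continuous_stdNormalPDF : Continuous stdNormalPDF := by
  rw [funext stdNormalPDF_eq]; fun_prop

lemma hasDerivAt_stdNormalPDF (x : ℝ) : HasDerivAt stdNormalPDF (-(x * stdNormalPDF x)) x := by
  rw [funext stdNormalPDF_eq]
  have h : HasDerivAt (fun x : ℝ => -x ^ 2 / 2) (-x) x :=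
    ((hasDerivAt_pow 2 x).neg.div_const 2).congr_deriv (by push_cast; ring)
  exact (h.exp.const_mul (√(2 * Real.pi))⁻¹).congr_deriv (by ring)

lemma stdNormalCDF_eq_integral (x : ℝ) :
    stdNormalCDF x = ∫ y in Set.Iic x, stdNormalPDF y := by
  rw [stdNormalCDF, cdf_eq_real, measureReal_def,
    gaussianReal_apply_eq_integral _ one_ne_zero, ENNReal.toReal_ofReal]
  · rfl
  · exact integral_nonneg fun y => (stdNormalPDF_pos y).le

lemma hasDerivAt_stdNormalCDF (x : ℝ) : HasDerivAt stdNormalCDF (stdNormalPDF x) x := by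
  have h : stdNormalCDF = fun x => stdNormalCDF 0 + ∫ y in (0 : ℝ)..x, stdNormalPDF y := by
    ext x
    rw [intervalIntegral.integral_Iic_sub_Iic
      integrable_stdNormalPDF.integrableOn integrable_stdNormalPDF.integrableOn |>.symm,
      ← stdNormalCDF_eq_integral, ← stdNormalCDF_eq_integral]
    ring
  rw [h]
  exact (intervalIntegral.integral_hasDerivAt_right
    integrable_stdNormalPDF.intervalIntegrable
    continuous_stdNormalPDF.stronglyMeasurable.stronglyMeasurableAtFilter
    continuous_stdNormalPDF.continuousAt).const_add _

lemma continuous_stdNormalCDF : Continuous stdNormalCDF :=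
  continuous_iff_continuousAt.2 fun x => (hasDerivAt_stdNormalCDF x).continuousAt

lemma stdNormalCDF_le_one (x : ℝ) : stdNormalCDF x ≤ 1 := cdf_le_one _ _

lemma stdNormalCDF_pos (x : ℝ) : 0 < stdNormalCDF x := by
  have := strictMono_of_hasDerivAt_pos hasDerivAt_stdNormalCDF stdNormalPDF_pos
  exact (stdNormalCDF_nonneg (x - 1)).trans_lt (this (by linarith))

lemma abs_stdNormalCDF_pow_le_one (x : ℝ) (m : ℕ) : ‖stdNormalCDF x ^ m‖ ≤ 1 := by
  rw [norm_pow, Real.norm_of_nonneg (stdNormalCDF_nonneg x)]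
  exact pow_le_one₀ (stdNormalCDF_nonneg x) (stdNormalCDF_le_one x)

/-- Integrals against the standard normal law in terms of its density. -/
lemma integral_stdNormal (f : ℝ → ℝ) :
    ∫ x, f x ∂gaussianReal 0 1 = ∫ x, f x * stdNormalPDF x := by
  rw [integral_gaussianReal_eq_integral_smul one_ne_zero]
  simp [stdNormalPDF, mul_comm]

lemma integrable_stdNormal_iff (f : ℝ → ℝ) :
    Integrable f (gaussianReal 0 1) ↔ Integrable fun x => f x * stdNormalPDF x := by
  rw [gaussianReal_of_var_ne_zero _ one_ne_zero, integrable_withDensity_iff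
    (measurable_gaussianPDF 0 1) (.of_forall fun x => gaussianPDF_lt_top)]
  simp [stdNormalPDF, toReal_gaussianPDF]

lemma integrable_pow_stdNormal (k : ℕ) : Integrable (fun x => x ^ k) (gaussianReal 0 1) := by
  have h := (memLp_id_gaussianReal (μ := 0) (v := 1) k).integrable_norm_pow'
  refine h.mono' (by fun_prop) (.of_forall fun x => ?_)
  simp

/-- Stein's identity for the standard normal law. -/
lemma integral_id_mul_stdNormal {u u' : ℝ → ℝ} (hu : ∀ x, HasDerivAt u (u' x) x)
    (h0 : Integrable u (gaussianReal 0 1)) (h' : Integrable u' (gaussianReal 0 1))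
    (h1 : Integrable (fun x => x * u x) (gaussianReal 0 1)) :
    ∫ x, x * u x ∂gaussianReal 0 1 = ∫ x, u' x ∂gaussianReal 0 1 := by
  rw [integrable_stdNormal_iff] at h0 h' h1
  -- Integration by parts with φ' = -xφ; integrability of uφ makes the boundary terms vanish.
  have h := integral_mul_deriv_eq_deriv_mul_of_integrable (u := u) (u' := u')
    (v := stdNormalPDF) (v' := fun x => -(x * stdNormalPDF x)) (fun x _ => hu x)
    (fun x _ => hasDerivAt_stdNormalPDF x)
    (h1.neg.congr (.of_forall fun x => by simp; ring)) h' h0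
  rw [integral_stdNormal, integral_stdNormal, ← neg_inj, ← h, ← integral_neg]
  congr 1; ext x; ring

/-! ### The law of the maximum and its moment generating function -/

/-- The density `n Φ ^ (n - 1)` of `X_(n)` with respect to the standard normal law. -/
def maxDensity (n : ℕ+) (x : ℝ) : ℝ := ((n : ℕ) : ℝ) * stdNormalCDF x ^ ((n : ℕ) - 1)

lemma maxDensity_nonneg (n : ℕ+) (x : ℝ) : 0 ≤ maxDensity n x :=
  mul_nonneg (Nat.cast_nonneg _) (pow_nonneg (stdNormalCDF_nonneg x) _)

lemma maxDensity_le (n : ℕ+) (x : ℝ) : maxDensity n x ≤ ((n : ℕ) : ℝ) :=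
  mul_le_of_le_one_right (Nat.cast_nonneg _)
    (pow_le_one₀ (stdNormalCDF_nonneg x) (stdNormalCDF_le_one x))

lemma continuous_maxDensity (n : ℕ+) : Continuous (maxDensity n) :=
  continuous_const.mul (continuous_stdNormalCDF.pow _)

lemma integral_Iic_maxDensity (n : ℕ+) (y : ℝ) :
    ∫ x in Set.Iic y, maxDensity n x * stdNormalPDF x = stdNormalCDF y ^ (n : ℕ) := by
  have hd (x : ℝ) : HasDerivAt (fun x => stdNormalCDF x ^ (n : ℕ))
      (maxDensity n x * stdNormalPDF x) x := (hasDerivAt_stdNormalCDF x).pow _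
  have hi : Integrable fun x => maxDensity n x * stdNormalPDF x :=
    integrable_stdNormalPDF.bdd_mul (c := ((n : ℕ) : ℝ))
      (continuous_maxDensity n).aestronglyMeasurable
      (.of_forall fun x => by
        rw [Real.norm_of_nonneg (maxDensity_nonneg n x)]; exact maxDensity_le n x)
  rw [integral_Iic_of_hasDerivAt_of_tendsto' (m := 0) (fun x _ => hd x) hi.integrableOn, sub_zero]
  have := (tendsto_cdf_atBot (gaussianReal 0 1)).pow (n : ℕ)
  rwa [zero_pow n.ne_zero] at this

lemma normalMaxLaw_Iic (n : ℕ+) (y : ℝ) :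
    normalMaxLaw n (Set.Iic y) = ENNReal.ofReal (stdNormalCDF y ^ (n : ℕ)) := by
  have : Nonempty (Fin (n : ℕ)) := ⟨⟨0, n.pos⟩⟩
  rw [normalMaxLaw, Measure.map_apply (Measurable.iSup fun i => measurable_pi_apply i)
    measurableSet_Iic]
  have : (fun x : Fin (n : ℕ) → ℝ => ⨆ i, x i) ⁻¹' Set.Iic y = Set.univ.pi fun _ => Set.Iic y := by
    ext x
    simp [ciSup_le_iff (Set.finite_range x).bddAbove, Pi.le_def]
  rw [this, Measure.pi_pi]
  simp [stdNormalCDF, ofReal_cdf, ENNReal.ofReal_pow (cdf_nonneg _ _)]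

instance isProbabilityMeasure_normalMaxLaw (n : ℕ+) : IsProbabilityMeasure (normalMaxLaw n) := by
  have : Nonempty (Fin (n : ℕ)) := ⟨⟨0, n.pos⟩⟩
  exact Measure.isProbabilityMeasure_map
    (Measurable.iSup fun i => measurable_pi_apply i).aemeasurable

lemma normalMaxLaw_eq (n : ℕ+) :
    normalMaxLaw n =
      (gaussianReal 0 1).withDensity fun x => ENNReal.ofReal (maxDensity n x) := by
  refine Measure.ext_of_Iic _ _ fun y => ?_
  have hm := (continuous_maxDensity n).measurable
  rw [normalMaxLaw_Iic, ← integral_Iic_maxDensity, gaussianReal_of_var_ne_zero _ one_ne_zero,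
    ← withDensity_mul _ (measurable_gaussianPDF 0 1) hm.ennreal_ofReal,
    withDensity_apply _ measurableSet_Iic, ofReal_integral_eq_lintegral_ofReal]
  · refine lintegral_congr fun x => ?_
    rw [ENNReal.ofReal_mul' (stdNormalPDF_pos x).le, mul_comm]; rfl
  · exact ((integrable_stdNormal_iff _).1 (Integrable.of_bound (C := ((n : ℕ) : ℝ))
      hm.aestronglyMeasurable (.of_forall fun x => by
        rw [Real.norm_of_nonneg (maxDensity_nonneg n x)]; exact maxDensity_le n x))).integrableOn
  · exact .of_forall fun x => mul_nonneg (maxDensity_nonneg n x) (stdNormalPDF_pos x).le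

lemma integral_normalMaxLaw (n : ℕ+) (f : ℝ → ℝ) :
    ∫ x, f x ∂normalMaxLaw n = ∫ x, maxDensity n x * f x ∂gaussianReal 0 1 := by
  rw [normalMaxLaw_eq, integral_withDensity_eq_integral_toReal_smul
    (continuous_maxDensity n).measurable.ennreal_ofReal (.of_forall fun x => ENNReal.ofReal_lt_top)]
  simp [ENNReal.toReal_ofReal (maxDensity_nonneg n _)]

lemma normalMaxLaw_le (n : ℕ+) : normalMaxLaw n ≤ ((n : ℕ) : ENNReal) • gaussianReal 0 1 := by
  rw [normalMaxLaw_eq, ← withDensity_const]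
  refine withDensity_mono (.of_forall fun x => ?_)
  exact (ENNReal.ofReal_le_ofReal (maxDensity_le n x)).trans_eq (ENNReal.ofReal_natCast _)

lemma integrable_normalMaxLaw (n : ℕ+) {f : ℝ → ℝ} (hf : Integrable f (gaussianReal 0 1)) :
    Integrable f (normalMaxLaw n) :=
  (hf.smul_measure (ENNReal.natCast_ne_top _)).mono_measure (normalMaxLaw_le n)

/-- Completing the square: exponential tilting of the standard normal law is translation by t. -/
lemma integral_comp_add_mul_exp (g : ℝ → ℝ) (t : ℝ) :
    ∫ x, g x * Real.exp (t * x) ∂gaussianReal 0 1 =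
      Real.exp (1 / 2 * t ^ 2) * ∫ x, g (t + x) ∂gaussianReal 0 1 := by
  rw [integral_stdNormal, integral_stdNormal, ← integral_const_mul,
    ← integral_add_left_eq_self (fun x => g x * Real.exp (t * x) * stdNormalPDF x) t]
  congr 1
  ext x
  have : Real.exp (t * (t + x)) * Real.exp (-(t + x) ^ 2 / 2) =
      Real.exp (1 / 2 * t ^ 2) * Real.exp (-x ^ 2 / 2) := by
    rw [← Real.exp_add, ← Real.exp_add]; congr 1; ring
  rw [stdNormalPDF_eq, stdNormalPDF_eq]
  linear_combination g (t + x) * (√(2 * Real.pi))⁻¹ * this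

lemma mgf_normalMaxLaw (n : ℕ+) (t : ℝ) :
    mgf id (normalMaxLaw n) t = Real.exp (1 / 2 * t ^ 2) *
      (((n : ℕ) : ℝ) * mvnCDF (t • ones ((n : ℕ) - 1)) (equiCov ((n : ℕ) - 1) 1)) := by
  have h := mvnCDF_equiCov ((n : ℕ) - 1) t 1
  rw [one_pow] at h
  simp only [mgf, id, integral_normalMaxLaw, integral_comp_add_mul_exp]
  rw [h]
  simp [maxDensity, integral_const_mul]

/-- The mgf of X_(n) equals 1 at t = 0. This trades the factor n for the denominator in the moment
recurrence. -/
lemma mvnCDF_zero_equiCov_one (n : ℕ+) :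
    mvnCDF 0 (equiCov ((n : ℕ) - 1) 1) = ((n : ℕ) : ℝ)⁻¹ := by
  have h := mgf_normalMaxLaw n 0
  rw [mgf_zero, zero_smul] at h
  simp only [ne_eq, OfNat.ofNat_ne_zero, not_false_eq_true, zero_pow, mul_zero, Real.exp_zero,
    one_mul] at h
  exact eq_inv_of_mul_eq_one_right h.symm

/-! ### The skew-normal laws of Z_m -/

lemma mvnCDF_zero_equiCov_half (m : ℕ) :
    mvnCDF 0 (equiCov m (1 / 2)) =
      ∫ z, stdNormalCDF (1 / √2 * z) ^ m ∂gaussianReal 0 1 := by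
  have h := mvnCDF_equiCov m 0 (1 / √2)
  simpa using h

lemma integrable_mul_pow {g : ℝ → ℝ} (hg : Continuous g) {c : ℝ} (hc : ∀ x, ‖g x‖ ≤ c) (k : ℕ) :
    Integrable (fun x => g x * x ^ k) (gaussianReal 0 1) :=
  (integrable_pow_stdNormal k).bdd_mul hg.aestronglyMeasurable (.of_forall hc)

lemma continuous_stdNormalCDF_half_pow (m : ℕ) :
    Continuous fun z => stdNormalCDF (1 / √2 * z) ^ m :=
  (continuous_stdNormalCDF.comp (continuous_const.mul continuous_id)).pow m

lemma mvnCDF_zero_equiCov_half_pos (m : ℕ) : 0 < mvnCDF 0 (equiCov m (1 / 2)) := by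
  have hp (z : ℝ) : 0 < stdNormalCDF (1 / √2 * z) ^ m := pow_pos (stdNormalCDF_pos _) m
  have hi : Integrable (fun z => stdNormalCDF (1 / √2 * z) ^ m) (gaussianReal 0 1) := by
    simpa using integrable_mul_pow (continuous_stdNormalCDF_half_pow m)
      (fun z => abs_stdNormalCDF_pow_le_one _ m) 0
  rw [mvnCDF_zero_equiCov_half, integral_pos_iff_support_of_nonneg (fun z => (hp z).le) hi]
  have : (Function.support fun z => stdNormalCDF (1 / √2 * z) ^ m) = Set.univ := by
    ext z; simpa using (hp z).ne'
  rw [this]; simp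

/-- With identity covariance Φ_m factorises into a power of Φ, so Z_m is a bounded reweighting of
the normal law. -/
lemma halfSkewLaw_eq (m : ℕ) :
    halfSkewLaw m = (gaussianReal 0 1).withDensity fun z =>
      ENNReal.ofReal (stdNormalCDF (1 / √2 * z) ^ m / mvnCDF 0 (equiCov m (1 / 2))) := by
  have h : (1 / 2 : ℝ) = (1 / √2) ^ 2 := by simp
  rw [gaussianReal_of_var_ne_zero _ one_ne_zero, ← withDensity_mul _ (measurable_gaussianPDF 0 1)
    ((continuous_stdNormalCDF_half_pow m).div_const _).measurable.ennreal_ofReal,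
    halfSkewLaw, skewNormalLaw]
  congr 1
  ext z
  rw [skewNormalPDF, mvnCDF_one, ← equiCov_eq, ← h, mul_div_assoc,
    ENNReal.ofReal_mul (stdNormalPDF_pos z).le]
  simp [ones, stdNormalPDF, gaussianPDF, mul_comm]

instance isProbabilityMeasure_halfSkewLaw (m : ℕ) : IsProbabilityMeasure (halfSkewLaw m) := by
  have hc := mvnCDF_zero_equiCov_half_pos m
  refine ⟨?_⟩
  rw [halfSkewLaw_eq, withDensity_apply _ .univ, Measure.restrict_univ,
    ← ofReal_integral_eq_lintegral_ofReal, integral_div, ← mvnCDF_zero_equiCov_half, div_self hc.ne',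
    ENNReal.ofReal_one]
  · simpa using (integrable_mul_pow (continuous_stdNormalCDF_half_pow m)
      (fun z => abs_stdNormalCDF_pow_le_one _ m) 0).div_const (mvnCDF 0 (equiCov m (1 / 2)))
  · exact .of_forall fun z => div_nonneg (pow_nonneg (stdNormalCDF_nonneg _) m) hc.le

lemma integrable_pow_halfSkewLaw (m k : ℕ) : Integrable (fun z => z ^ k) (halfSkewLaw m) := by
  have hc := mvnCDF_zero_equiCov_half_pos m
  rw [halfSkewLaw_eq, integrable_withDensity_iff
    ((continuous_stdNormalCDF_half_pow m).div_const _).measurable.ennreal_ofReal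
    (.of_forall fun x => ENNReal.ofReal_lt_top)]
  refine ((integrable_mul_pow (continuous_stdNormalCDF_half_pow m)
    (fun z => abs_stdNormalCDF_pow_le_one _ m) k).div_const (mvnCDF 0 (equiCov m (1 / 2)))).congr
    (.of_forall fun z => ?_)
  simp only
  rw [ENNReal.toReal_ofReal (div_nonneg (pow_nonneg (stdNormalCDF_nonneg _) m) hc.le)]
  ring

lemma mvnCDF_mul_integral_halfSkewLaw (m : ℕ) (f : ℝ → ℝ) :
    mvnCDF 0 (equiCov m (1 / 2)) * ∫ z, f z ∂halfSkewLaw m =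
      ∫ z, stdNormalCDF (1 / √2 * z) ^ m * f z ∂gaussianReal 0 1 := by
  have hc := mvnCDF_zero_equiCov_half_pos m
  rw [halfSkewLaw_eq, integral_withDensity_eq_integral_toReal_smul
    ((continuous_stdNormalCDF_half_pow m).div_const _).measurable.ennreal_ofReal
    (.of_forall fun x => ENNReal.ofReal_lt_top), ← integral_const_mul]
  congr 1
  ext z
  rw [ENNReal.toReal_ofReal (div_nonneg (pow_nonneg (stdNormalCDF_nonneg _) m) hc.le), smul_eq_mul]
  field_simp

/-! ### Moment recurrence for the maximum -/

/-- Since φ(x)² = φ(√2 x)/√(2π), substituting z = √2 x gives the constant 1/(√(2π)√2) = 1/(2√π). -/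
lemma integral_mul_stdNormalPDF (g : ℝ → ℝ) :
    ∫ x, g x * stdNormalPDF x ∂gaussianReal 0 1 =
      1 / (2 * √Real.pi) * ∫ z, g (1 / √2 * z) ∂gaussianReal 0 1 := by
  have hsq (x : ℝ) : stdNormalPDF x * stdNormalPDF x =
      (√(2 * Real.pi))⁻¹ * stdNormalPDF (√2 * x) := by
    rw [stdNormalPDF_eq, stdNormalPDF_eq]
    have : Real.exp (-x ^ 2 / 2) * Real.exp (-x ^ 2 / 2) = Real.exp (-(√2 * x) ^ 2 / 2) := by
      rw [← Real.exp_add]; congr 1; rw [mul_pow, Real.sq_sqrt two_pos.le]; ring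
    linear_combination (√(2 * Real.pi))⁻¹ * (√(2 * Real.pi))⁻¹ * this
  have h2 : √2 ≠ 0 := by positivity
  have h := Measure.integral_comp_mul_left
    (fun z => g (1 / √2 * z) * stdNormalPDF z) √2
  rw [integral_stdNormal, integral_stdNormal]
  calc ∫ x, g x * stdNormalPDF x * stdNormalPDF x
      = ∫ x, (√(2 * Real.pi))⁻¹ * (g (1 / √2 * (√2 * x)) * stdNormalPDF (√2 * x)) := by
        congr 1; ext x
        rw [mul_assoc, hsq, ← mul_assoc (1 / √2), one_div_mul_cancel h2, one_mul]; ring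
    _ = _ := by
        rw [integral_const_mul, h, abs_of_pos (by positivity), smul_eq_mul, ← mul_assoc]
        congr 1
        rw [Real.sqrt_mul two_pos.le]
        have : √2 * √2 = 2 := Real.mul_self_sqrt two_pos.le
        field_simp
        linarith

lemma stdNormalPDF_le_one (x : ℝ) : stdNormalPDF x ≤ 1 := by
  rw [stdNormalPDF_eq]
  refine mul_le_one₀ (inv_le_one_of_one_le₀ ?_) (Real.exp_pos _).le (Real.exp_le_one_iff.2 ?_)
  · exact Real.one_le_sqrt.2 (by linarith [Real.two_le_pi])
  · nlinarith [sq_nonneg x]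

/-- The moment recurrence for the maximum of `n` independent standard normal variables. -/
lemma integral_pow_succ_normalMaxLaw (n : ℕ+) (k : ℕ) :
    ∫ x, x ^ (k + 1) ∂normalMaxLaw n =
      k * (∫ x, x ^ (k - 1) ∂normalMaxLaw n) +
        ((n : ℕ) : ℝ) * (((n : ℕ) : ℝ) - 1) * mvnCDF 0 (equiCov ((n : ℕ) - 2) (1 / 2)) /
          (2 * √Real.pi * √2 ^ k) * ∫ z, z ^ k ∂halfSkewLaw ((n : ℕ) - 2) := by
  set m := (n : ℕ) - 2 with hm
  -- The coefficient from differentiating nΦ^(n-1). It vanishes at n = 1, where the truncated m is 0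
  -- rather than -1.
  set c : ℝ := ((n : ℕ) : ℝ) * (((n : ℕ) : ℝ) - 1) with hc
  have hbd (x : ℝ) : ‖maxDensity n x‖ ≤ ((n : ℕ) : ℝ) := by
    rw [Real.norm_of_nonneg (maxDensity_nonneg n x)]; exact maxDensity_le n x
  have hD (k : ℕ) := integrable_mul_pow (continuous_maxDensity n) hbd k
  have hE : Integrable (fun x => stdNormalCDF x ^ m * x ^ k * stdNormalPDF x)
      (gaussianReal 0 1) := by
    refine (integrable_mul_pow (g := fun x => stdNormalCDF x ^ m * stdNormalPDF x) (c := 1)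
      ((continuous_stdNormalCDF.pow m).mul continuous_stdNormalPDF) (fun x => ?_) k).congr
      (.of_forall fun x => by simp only; ring)
    rw [norm_mul, Real.norm_of_nonneg (stdNormalPDF_pos x).le]
    exact mul_le_one₀ (abs_stdNormalCDF_pow_le_one x m) (stdNormalPDF_pos x).le
      (stdNormalPDF_le_one x)
  have hd (x : ℝ) : HasDerivAt (fun x => maxDensity n x * x ^ k)
      (k * (maxDensity n x * x ^ (k - 1)) + c * (stdNormalCDF x ^ m * x ^ k * stdNormalPDF x))
      x := by
    have h1 : HasDerivAt (maxDensity n) (((n : ℕ) : ℝ) * ((((n : ℕ) - 1 : ℕ) : ℝ) *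
        stdNormalCDF x ^ ((n : ℕ) - 1 - 1) * stdNormalPDF x)) x :=
      ((hasDerivAt_stdNormalCDF x).pow _).const_mul _
    refine (h1.mul (hasDerivAt_pow k x)).congr_deriv ?_
    rw [Nat.cast_pred n.pos, Nat.sub_sub, ← hm, hc]
    ring
  have hS := integral_id_mul_stdNormal hd (hD k)
    (((hD (k - 1)).const_mul _).add (hE.const_mul c))
    ((hD (k + 1)).congr (.of_forall fun x => by simp only; ring))
  rw [integral_add ((hD (k - 1)).const_mul _) (hE.const_mul c), integral_const_mul,
    integral_const_mul, integral_mul_stdNormalPDF (fun x => stdNormalCDF x ^ m * x ^ k),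
    ← integral_normalMaxLaw n (fun x => x ^ (k - 1))] at hS
  -- The rescaled power (z/√2)^k accounts for the factor 2^(k/2) in the denominator.
  have hz : ∫ z, stdNormalCDF (1 / √2 * z) ^ m * (1 / √2 * z) ^ k ∂gaussianReal 0 1 =
      (√2 ^ k)⁻¹ * (mvnCDF 0 (equiCov m (1 / 2)) * ∫ z, z ^ k ∂halfSkewLaw m) := by
    rw [mvnCDF_mul_integral_halfSkewLaw, ← integral_const_mul]
    congr 1; ext z
    rw [mul_pow, one_div, inv_pow]; ring
  rw [hz] at hS
  rw [integral_normalMaxLaw]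
  calc _ = _ := by congr 1; ext x; ring
    _ = _ := hS
    _ = _ := by congr 1; field_simp

/-! ### Power series weights and the mixture representation -/

variable {a : ℕ+ → ℝ} {θ : ℝ}

lemma powerSeries_pos (ha : ∀ n, 0 ≤ a n) (ha' : ∃ n, 0 < a n) (hθ : 0 < θ)
    (hs : Summable fun n : ℕ+ => a n * θ ^ (n : ℕ)) : 0 < powerSeries a θ := by
  obtain ⟨n, hn⟩ := ha'
  exact hs.tsum_pos (fun n => mul_nonneg (ha n) (pow_nonneg hθ.le _)) n
    (mul_pos hn (pow_pos hθ _))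

lemma powerSeriesPMF_nonneg (ha : ∀ n, 0 ≤ a n) (hθ : 0 < θ) (n : ℕ+) :
    0 ≤ powerSeriesPMF a θ n := by
  have h (n : ℕ+) : 0 ≤ a n * θ ^ (n : ℕ) := mul_nonneg (ha n) (pow_nonneg hθ.le _)
  exact div_nonneg (h n) (tsum_nonneg h)

lemma hasSum_powerSeriesPMF (ha : ∀ n, 0 ≤ a n) (ha' : ∃ n, 0 < a n) (hθ : 0 < θ)
    (hs : Summable fun n : ℕ+ => a n * θ ^ (n : ℕ)) : HasSum (powerSeriesPMF a θ) 1 := by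
  have := hs.hasSum.div_const (powerSeries a θ)
  rwa [← powerSeries, div_self (powerSeries_pos ha ha' hθ hs).ne'] at this

/-- Each a_n x^n is at most the whole sum, so a_n θ^n n is dominated by a constant times n(θ/x)^n.
-/
lemma summable_powerSeriesPMF_mul_natCast (ha : ∀ n, 0 ≤ a n) (hθ : 0 < θ) {x : ℝ} (hx : θ < x)
    (hs : Summable fun n : ℕ+ => a n * x ^ (n : ℕ)) :
    Summable fun n : ℕ+ => powerSeriesPMF a θ n * ((n : ℕ) : ℝ) := by
  have hx0 : 0 < x := hθ.trans hx
  have hr : ‖θ / x‖ < 1 := by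
    rw [Real.norm_of_nonneg (by positivity)]; exact (div_lt_one hx0).2 hx
  have hg := ((summable_pow_mul_geometric_of_norm_lt_one 1 hr).comp_injective
    PNat.coe_injective).mul_left (∑' n : ℕ+, a n * x ^ (n : ℕ))
  have hn (n : ℕ+) : 0 ≤ a n * x ^ (n : ℕ) := mul_nonneg (ha n) (pow_nonneg hx0.le _)
  have h : Summable fun n : ℕ+ => a n * θ ^ (n : ℕ) * ((n : ℕ) : ℝ) := by
    refine Summable.of_nonneg_of_le (fun n => ?_) (fun n => ?_) hg
    · have := ha n; positivity
    · have := hs.le_tsum n fun m _ => hn m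
      calc a n * θ ^ (n : ℕ) * ((n : ℕ) : ℝ)
          = a n * x ^ (n : ℕ) * (((n : ℕ) : ℝ) ^ 1 * (θ / x) ^ (n : ℕ)) := by
            rw [div_pow]; field_simp
        _ ≤ _ := mul_le_mul_of_nonneg_right this (by positivity)
  refine (h.div_const (powerSeries a θ)).congr fun n => ?_
  rw [powerSeriesPMF]; ring

section Law

variable {Ω : Type*} [MeasurableSpace Ω] {P : Measure Ω} [IsProbabilityMeasure P] {Y : Ω → ℝ}

/-- The law of `Y ∼ NPS(0, 1, θ)` is the mixture, with weights `P(N = n)`, of the laws of the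
maxima of `n` independent standard normal variables. -/
lemma HasLawNPS.map_eq (hY : HasLawNPS Y P a 0 1 θ) (ha : ∀ n, 0 ≤ a n) (hθ : 0 < θ)
    (hp : Summable (powerSeriesPMF a θ)) :
    P.map Y = Measure.sum fun n => ENNReal.ofReal (powerSeriesPMF a θ n) • normalMaxLaw n := by
  have hprob : IsProbabilityMeasure (P.map Y) := Measure.isProbabilityMeasure_map hY.aemeasurable
  refine Measure.ext_of_Iic _ _ fun y => ?_
  have h1 : P.map Y (Set.Iic y) = ENNReal.ofReal (cdfNPS a 0 1 θ y) := by
    rw [← hY.cdf_eq, ofReal_measureReal, Measure.map_apply_of_aemeasurable hY.aemeasurable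
      measurableSet_Iic]
    rfl
  have h2 : cdfNPS a 0 1 θ y = ∑' n, powerSeriesPMF a θ n * stdNormalCDF y ^ (n : ℕ) := by
    rw [cdfNPS, powerSeries, ← tsum_div_const]
    congr 1; ext n
    rw [powerSeriesPMF, sub_zero, div_one, mul_pow]; ring
  have h0 (n : ℕ+) := powerSeriesPMF_nonneg ha hθ n
  have h3 (n : ℕ+) : 0 ≤ stdNormalCDF y ^ (n : ℕ) := pow_nonneg (stdNormalCDF_nonneg y) _
  rw [h1, h2, Measure.sum_apply _ measurableSet_Iic, ENNReal.ofReal_tsum_of_nonneg]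
  · congr 1; ext n
    rw [Measure.smul_apply, normalMaxLaw_Iic, smul_eq_mul, ENNReal.ofReal_mul (h0 n)]
  · exact fun n => mul_nonneg (h0 n) (h3 n)
  · exact Summable.of_nonneg_of_le (fun n => mul_nonneg (h0 n) (h3 n))
      (fun n => mul_le_of_le_one_right (h0 n)
        (pow_le_one₀ (stdNormalCDF_nonneg y) (stdNormalCDF_le_one y))) hp

/-- Each component of the mixture is at most n times the Gaussian. This single domination supplies
all integrability under Y. -/
lemma HasLawNPS.map_le (hY : HasLawNPS Y P a 0 1 θ) (ha : ∀ n, 0 ≤ a n) (hθ : 0 < θ)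
    (hp : Summable (powerSeriesPMF a θ))
    (hp1 : Summable fun n : ℕ+ => powerSeriesPMF a θ n * ((n : ℕ) : ℝ)) :
    P.map Y ≤ ENNReal.ofReal (∑' n : ℕ+, powerSeriesPMF a θ n * ((n : ℕ) : ℝ)) •
      gaussianReal 0 1 := by
  have h0 (n : ℕ+) := powerSeriesPMF_nonneg ha hθ n
  rw [hY.map_eq ha hθ hp, ENNReal.ofReal_tsum_of_nonneg
    (fun n => mul_nonneg (h0 n) (Nat.cast_nonneg _)) hp1]
  refine Measure.le_iff.2 fun s hs => ?_
  rw [Measure.sum_apply _ hs, Measure.smul_apply, smul_eq_mul, ← ENNReal.tsum_mul_right]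
  refine ENNReal.tsum_le_tsum fun n => ?_
  rw [Measure.smul_apply, smul_eq_mul, ENNReal.ofReal_mul (h0 n), ENNReal.ofReal_natCast, mul_assoc]
  exact mul_le_mul_right (normalMaxLaw_le n s) _

lemma HasLawNPS.integrable_comp (hY : HasLawNPS Y P a 0 1 θ) (ha : ∀ n, 0 ≤ a n) (hθ : 0 < θ)
    (hp : Summable (powerSeriesPMF a θ))
    (hp1 : Summable fun n : ℕ+ => powerSeriesPMF a θ n * ((n : ℕ) : ℝ))
    {f : ℝ → ℝ} (hf : Integrable f (gaussianReal 0 1)) : Integrable (fun ω => f (Y ω)) P :=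
  ((hf.smul_measure ENNReal.ofReal_ne_top).mono_measure
    (hY.map_le ha hθ hp hp1)).comp_aemeasurable hY.aemeasurable

lemma HasLawNPS.hasSum_integral_comp (hY : HasLawNPS Y P a 0 1 θ) (ha : ∀ n, 0 ≤ a n) (hθ : 0 < θ)
    (hp : Summable (powerSeriesPMF a θ))
    (hp1 : Summable fun n : ℕ+ => powerSeriesPMF a θ n * ((n : ℕ) : ℝ))
    {f : ℝ → ℝ} (hf : Integrable f (gaussianReal 0 1)) :
    HasSum (fun n => powerSeriesPMF a θ n * ∫ x, f x ∂normalMaxLaw n) (∫ ω, f (Y ω) ∂P) := by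
  have hi : Integrable f (P.map Y) :=
    (hf.smul_measure ENNReal.ofReal_ne_top).mono_measure (hY.map_le ha hθ hp hp1)
  rw [← integral_map hY.aemeasurable hi.aestronglyMeasurable]
  rw [hY.map_eq ha hθ hp] at hi ⊢
  simpa [integral_smul_measure, powerSeriesPMF_nonneg ha hθ] using hasSum_integral_measure hi

end Law

end NPS

end

/-! ### Assembly of the theorem -/

theorem mainTheorem3 {Ω : Type*} [MeasurableSpace Ω] (P : Measure Ω) [IsProbabilityMeasure P]
    (a : ℕ+ → ℝ) (ha : ∀ n, 0 ≤ a n) (ha' : ∃ n, 0 < a n)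
    (s : EReal)
    (hs : ∀ x : ℝ, 0 < x → (x : EReal) < s → Summable fun n : ℕ+ => a n * x ^ (n : ℕ))
    (θ : ℝ) (hθ : 0 < θ) (hθs : (θ : EReal) < s)
    (Y : Ω → ℝ) (hY : NPS.HasLawNPS Y P a 0 1 θ) :
    -- moment generating function
    (∀ t : ℝ,
      Integrable (fun ω => Real.exp (t * Y ω)) P ∧
      (∀ n : ℕ+, Integrable (fun x => Real.exp (t * x)) (NPS.normalMaxLaw n)) ∧
      HasSum (fun n : ℕ+ => NPS.powerSeriesPMF a θ n * mgf id (NPS.normalMaxLaw n) t)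
        (mgf Y P t) ∧
      (Summable fun n : ℕ+ => NPS.powerSeriesPMF a θ n *
        (((n : ℕ) : ℝ) *
          NPS.mvnCDF (t • NPS.ones ((n : ℕ) - 1)) (NPS.equiCov ((n : ℕ) - 1) 1))) ∧
      mgf Y P t = Real.exp (1 / 2 * t ^ 2) *
        ∑' n : ℕ+, NPS.powerSeriesPMF a θ n *
          (((n : ℕ) : ℝ) *
            NPS.mvnCDF (t • NPS.ones ((n : ℕ) - 1)) (NPS.equiCov ((n : ℕ) - 1) 1)) ∧
      Integrable
        (fun n : ℕ => (n : ℝ) * NPS.mvnCDF (t • NPS.ones (n - 1)) (NPS.equiCov (n - 1) 1))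
        (NPS.powerSeriesLaw a θ) ∧
      mgf Y P t = Real.exp (1 / 2 * t ^ 2) *
        ∫ n : ℕ, (n : ℝ) * NPS.mvnCDF (t • NPS.ones (n - 1)) (NPS.equiCov (n - 1) 1)
          ∂(NPS.powerSeriesLaw a θ)) ∧
    -- For `n = 1` the terms with `n - 2` (truncated) carry the factor `n - 1 = 0`.
    -- all moments are finite, and the moments of order at least two satisfy a recurrence
    (∀ k : ℕ, Integrable (fun ω => Y ω ^ k) P) ∧
    (∀ k n : ℕ, IsProbabilityMeasure (NPS.halfSkewLaw n) ∧
      Integrable (fun z => z ^ k) (NPS.halfSkewLaw n)) ∧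
    (∀ k : ℕ, 1 ≤ k →
      (Summable fun n : ℕ+ => NPS.powerSeriesPMF a θ n * (k * ∫ ω, Y ω ^ (k - 1) ∂P)) ∧
      (Summable fun n : ℕ+ => NPS.powerSeriesPMF a θ n *
        ((((n : ℕ) : ℝ) - 1) * NPS.mvnCDF 0 (NPS.equiCov ((n : ℕ) - 2) (1 / 2)) /
          (2 * √Real.pi * √2 ^ k * NPS.mvnCDF 0 (NPS.equiCov ((n : ℕ) - 1) 1))) *
        ∫ z, z ^ k ∂(NPS.halfSkewLaw ((n : ℕ) - 2))) ∧
      ∫ ω, Y ω ^ (k + 1) ∂P =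
        (∑' n : ℕ+, NPS.powerSeriesPMF a θ n * (k * ∫ ω, Y ω ^ (k - 1) ∂P)) +
        (∑' n : ℕ+, NPS.powerSeriesPMF a θ n *
          ((((n : ℕ) : ℝ) - 1) * NPS.mvnCDF 0 (NPS.equiCov ((n : ℕ) - 2) (1 / 2)) /
            (2 * √Real.pi * √2 ^ k * NPS.mvnCDF 0 (NPS.equiCov ((n : ℕ) - 1) 1))) *
          ∫ z, z ^ k ∂(NPS.halfSkewLaw ((n : ℕ) - 2)))) ∧
    -- mean
    (Summable fun n : ℕ+ => NPS.powerSeriesPMF a θ n *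
      (((n : ℕ) : ℝ) * (((n : ℕ) : ℝ) - 1) *
        NPS.mvnCDF 0 (NPS.equiCov ((n : ℕ) - 2) (1 / 2)))) ∧
    ∫ ω, Y ω ∂P = 1 / (2 * √Real.pi) *
      ∑' n : ℕ+, NPS.powerSeriesPMF a θ n *
        (((n : ℕ) : ℝ) * (((n : ℕ) : ℝ) - 1) *
          NPS.mvnCDF 0 (NPS.equiCov ((n : ℕ) - 2) (1 / 2))) := by
  -- A point strictly inside the convergence range beyond θ is what makes E(N) finite.
  obtain ⟨x, hθx, hxs⟩ := EReal.lt_iff_exists_real_btwn.1 hθs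
  have hθx' : θ < x := EReal.coe_lt_coe_iff.1 hθx
  have h1 := NPS.hasSum_powerSeriesPMF ha ha' hθ (hs θ hθ hθs)
  have hp := h1.summable
  have hp1 := NPS.summable_powerSeriesPMF_mul_natCast ha hθ hθx' (hs x (hθ.trans hθx') hxs)
  have hexp (t : ℝ) : Integrable (fun x => Real.exp (t * x)) (gaussianReal 0 1) :=
    integrable_exp_mul_gaussianReal t
  have hmom (k : ℕ) := hY.hasSum_integral_comp ha hθ hp hp1 (NPS.integrable_pow_stdNormal k)
  -- Averaging the recurrence over n reassembles the lower moments of X_(n) into that of Y. The case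
  -- k = 0 is included: the truncated exponent k - 1 then carries the factor 0.
  have hrec (k : ℕ) : HasSum (fun n : ℕ+ => NPS.powerSeriesPMF a θ n *
      (((n : ℕ) : ℝ) * (((n : ℕ) : ℝ) - 1) * NPS.mvnCDF 0 (NPS.equiCov ((n : ℕ) - 2) (1 / 2)) /
          (2 * √Real.pi * √2 ^ k) * ∫ z, z ^ k ∂NPS.halfSkewLaw ((n : ℕ) - 2)))
      (∫ ω, Y ω ^ (k + 1) ∂P - k * ∫ ω, Y ω ^ (k - 1) ∂P) := by
    convert! (hmom (k + 1)).sub ((hmom (k - 1)).mul_left (k : ℝ)) using 2 with n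
    rw [NPS.integral_pow_succ_normalMaxLaw]
    ring
  refine ⟨fun t => ?_, fun k => hY.integrable_comp ha hθ hp hp1 (NPS.integrable_pow_stdNormal k),
    fun k n => ⟨inferInstance, NPS.integrable_pow_halfSkewLaw n k⟩, fun k _ => ?_, ?_⟩
  · have hm : HasSum (fun n : ℕ+ => NPS.powerSeriesPMF a θ n * mgf id (NPS.normalMaxLaw n) t)
        (mgf Y P t) := hY.hasSum_integral_comp ha hθ hp hp1 (hexp t)
    have hm' : HasSum (fun n : ℕ+ => NPS.powerSeriesPMF a θ n * (((n : ℕ) : ℝ) *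
        NPS.mvnCDF (t • NPS.ones ((n : ℕ) - 1)) (NPS.equiCov ((n : ℕ) - 1) 1)))
        ((Real.exp (1 / 2 * t ^ 2))⁻¹ * mgf Y P t) := by
      convert! hm.mul_left (Real.exp (1 / 2 * t ^ 2))⁻¹ using 2 with n
      rw [NPS.mgf_normalMaxLaw, mul_left_comm (NPS.powerSeriesPMF a θ n) (Real.exp _),
        inv_mul_cancel_left₀ (Real.exp_ne_zero _)]
    have hS : Summable fun n : ℕ+ => (ENNReal.ofReal (NPS.powerSeriesPMF a θ n)).toReal *
        ‖((n : ℕ) : ℝ) * NPS.mvnCDF (t • NPS.ones ((n : ℕ) - 1)) (NPS.equiCov ((n : ℕ) - 1) 1)‖ := by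
      refine hm'.summable.congr fun n => ?_
      rw [ENNReal.toReal_ofReal (NPS.powerSeriesPMF_nonneg ha hθ n),
        Real.norm_of_nonneg (mul_nonneg (Nat.cast_nonneg _) (NPS.mvnCDF_nonneg _ _))]
    have hI : ∫ n : ℕ, (n : ℝ) * NPS.mvnCDF (t • NPS.ones (n - 1)) (NPS.equiCov (n - 1) 1)
        ∂(NPS.powerSeriesLaw a θ) = (Real.exp (1 / 2 * t ^ 2))⁻¹ * mgf Y P t := by
      rw [NPS.powerSeriesLaw, integral_sum_dirac fun n => ENNReal.ofReal_ne_top, ← hm'.tsum_eq]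
      congr 1; ext n
      rw [ENNReal.toReal_ofReal (NPS.powerSeriesPMF_nonneg ha hθ n), smul_eq_mul]
    refine ⟨hY.integrable_comp ha hθ hp hp1 (hexp t),
      fun n => NPS.integrable_normalMaxLaw n (hexp t), hm, hm'.summable, ?_,
      integrable_sum_dirac (fun n => ENNReal.ofReal_ne_top) hS, ?_⟩
    · rw [hm'.tsum_eq, mul_inv_cancel_left₀ (Real.exp_ne_zero _)]
    · rw [hI, mul_inv_cancel_left₀ (Real.exp_ne_zero _)]
  · have hA := h1.mul_right (k * ∫ ω, Y ω ^ (k - 1) ∂P)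
    have hB : HasSum (fun n : ℕ+ => NPS.powerSeriesPMF a θ n *
        ((((n : ℕ) : ℝ) - 1) * NPS.mvnCDF 0 (NPS.equiCov ((n : ℕ) - 2) (1 / 2)) /
          (2 * √Real.pi * √2 ^ k * NPS.mvnCDF 0 (NPS.equiCov ((n : ℕ) - 1) 1))) *
        ∫ z, z ^ k ∂(NPS.halfSkewLaw ((n : ℕ) - 2)))
        (∫ ω, Y ω ^ (k + 1) ∂P - k * ∫ ω, Y ω ^ (k - 1) ∂P) := by
      convert! hrec k using 2 with n
      rw [NPS.mvnCDF_zero_equiCov_one]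
      field_simp
    refine ⟨hA.summable, hB.summable, ?_⟩
    rw [hA.tsum_eq, hB.tsum_eq]
    ring
  · have hC : HasSum (fun n : ℕ+ => NPS.powerSeriesPMF a θ n *
        (((n : ℕ) : ℝ) * (((n : ℕ) : ℝ) - 1) *
          NPS.mvnCDF 0 (NPS.equiCov ((n : ℕ) - 2) (1 / 2))))
        (2 * √Real.pi * ∫ ω, Y ω ∂P) := by
      -- The mean is the recurrence at k = 0, where the zeroth moment of each Z_(n-2) is 1.
      have h0 := (hrec 0).mul_left (2 * √Real.pi)
      simp only [zero_add, pow_one, CharP.cast_eq_zero, zero_mul, sub_zero] at h0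
      convert! h0 using 2 with n
      simp only [pow_zero, integral_const, probReal_univ, smul_eq_mul, mul_one]
      field_simp
    refine ⟨hC.summable, ?_⟩
    rw [hC.tsum_eq]
    field_simp
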